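/- Let $F$ be a field, and let $\Delta_1$ and $\Delta_2$ be finite-dimensional (abstract) simplicial complexes with disjoint vertex sets. Then \[ \operatorname{depth}_F(\Delta_1 * \Delta_2) = \operatorname{depth}_F \Delta_1 + \operatorname{depth}_F \Delta_2 + 1 . \] Here faces are finite sets, and the empty set is a face of every complex. The dimension of a face $\sigma$ is $|\sigma|-1$, and $\dim\Delta$ is the maximum of the dimensions of the faces of $\Delta$. The join $\Delta_1*\Delta_2$ has as faces the sets $\tau\cup\sigma$ with $\tau\in\Delta_1$ and $\sigma\in\Delta_2$. The link of a face $\sigma$ of $\Delta$ is $\operatorname{link}_\Delta\sigma=\{\tau : \tau\cup\sigma\in\Delta,\ \tau\cap\sigma=\emptyset\}$, and the $d$-skeleton $\Delta^{(d)}$ consists of all faces of $\Delta$ of dimension at most $d$. A complex $\Gamma$ is Cohen-Macaulay over $F$ if the reduced simplicial homology satisfies $\tilde H_i(\operatorname{link}_\Gamma\sigma;F)=0$ for all faces $\sigma$ of $\Gamma$ (including $\sigma=\emptyset$) and all $i<\dim(\operatorname{link}_\Gamma\sigma)$. Finally, \[ \operatorname{depth}_F\Delta=\max\{d : -1\le d\le\dim\Delta,\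 \Delta^{(d)}\text{ is Cohen-Macaulay over }F\}. \] -/

import Mathlib

/-!
# Depth of a simplicial complex over a field

Abstract simplicial complexes are Mathlib's `PreAbstractSimplicialComplex V`: downward closed
families of nonempty finite subsets of `V`.  The empty face is present in every complex but is not
recorded in `faces`; `IsFace` puts it back.  The vertices of `K` are the `v : V` that lie in a face,
so elements of `V` that are not vertices are allowed.
-/

namespace PreAbstractSimplicialComplex

variable {V : Type*}

/-- The faces of `K`, including the empty face. -/
def IsFace (K : PreAbstractSimplicialComplex V) (σ : Finset V) : Prop :=
  σ = ∅ ∨ σ ∈ K.faces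

theorem IsFace.subset {K : PreAbstractSimplicialComplex V} {σ τ : Finset V}
    (hσ : K.IsFace σ) (h : τ ⊆ σ) : K.IsFace τ := by
  rcases τ.eq_empty_or_nonempty with rfl | hτ
  · exact Or.inl rfl
  · rcases hσ with rfl | hσ
    · exact Or.inl (Finset.subset_empty.1 h)
    · exact Or.inr ((K.isRelLowerSet_faces hσ).2 h hτ)

/-- The vertices of `K`. -/
def vertices (K : PreAbstractSimplicialComplex V) : Set V :=
  {v | {v} ∈ K.faces}

/-- The dimensions of the faces of `K` (a face `σ` has dimension `|σ| - 1`) are bounded. -/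
def FiniteDimensional (K : PreAbstractSimplicialComplex V) : Prop :=
  BddAbove {d : ℤ | ∃ σ, K.IsFace σ ∧ d = (σ.card : ℤ) - 1}

/-- The dimension of a finite-dimensional complex, the maximum of the dimensions of its faces;
it is `-1` for the complex whose only face is empty. -/
noncomputable def dim (K : PreAbstractSimplicialComplex V) : ℤ :=
  sSup {d : ℤ | ∃ σ, K.IsFace σ ∧ d = (σ.card : ℤ) - 1}

/-- The `d`-skeleton: all faces of dimension at most `d`. -/
def skeleton (K : PreAbstractSimplicialComplex V) (d : ℤ) : PreAbstractSimplicialComplex V where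
  faces := {σ | σ ∈ K.faces ∧ (σ.card : ℤ) - 1 ≤ d}
  isRelLowerSet_faces := by
    rintro σ ⟨hσ, hd⟩
    refine ⟨(K.isRelLowerSet_faces hσ).1, fun τ hτσ hτ => ?_⟩
    refine ⟨(K.isRelLowerSet_faces hσ).2 hτσ hτ, ?_⟩
    have : τ.card ≤ σ.card := Finset.card_le_card hτσ
    omega

section DecidableEq

variable [DecidableEq V]

/-- The link of a face `σ`: all `τ` disjoint from `σ` such that `τ ∪ σ` is a face. -/
def link (K : PreAbstractSimplicialComplex V) (σ : Finset V) : PreAbstractSimplicialComplex V where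
  faces := {τ | τ.Nonempty ∧ K.IsFace (τ ∪ σ) ∧ Disjoint τ σ}
  isRelLowerSet_faces := by
    rintro τ ⟨hτ, hf, hd⟩
    exact ⟨hτ, fun ρ hρτ hρ => ⟨hρ, hf.subset (Finset.union_subset_union_left hρτ),
      Finset.disjoint_of_subset_left hρτ hd⟩⟩

/-- The join: its faces are the sets `τ ∪ σ` with `τ` a face of `K` and `σ` a face of `L`.
It is only used for complexes with disjoint vertex sets. -/
def join (K L : PreAbstractSimplicialComplex V) : PreAbstractSimplicialComplex V where
  faces := {ρ | ρ.Nonempty ∧ ∃ τ σ, K.IsFace τ ∧ L.IsFace σ ∧ ρ = τ ∪ σ}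
  isRelLowerSet_faces := by
    rintro ρ ⟨hρ, τ, σ, hτ, hσ, rfl⟩
    refine ⟨hρ, fun α hα hne => ⟨hne, α ∩ τ, α ∩ σ, hτ.subset Finset.inter_subset_right,
      hσ.subset Finset.inter_subset_right, ?_⟩⟩
    rw [← Finset.inter_union_distrib_left]
    exact (Finset.inter_eq_left.2 hα).symm

end DecidableEq

section Homology

/-- The quotient `Z / B` of two submodules `B ≤ Z` of a module. -/
abbrev SubmoduleQuotient {R M : Type*} [Ring R] [AddCommGroup M] [Module R M]
    (Z B : Submodule R M) : Type _ :=
  Z ⧸ B.submoduleOf Z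

theorem subsingleton_submoduleQuotient_iff {R M : Type*} [Ring R] [AddCommGroup M] [Module R M]
    (Z B : Submodule R M) : Subsingleton (SubmoduleQuotient Z B) ↔ Z ≤ B := by
  rw [Submodule.Quotient.subsingleton_iff, Submodule.submoduleOf_eq_top]

variable (F : Type*) [Field F] [LinearOrder V]

/-- The simplicial boundary map on the free module on all finite subsets of the linearly ordered
set `V`: the set `{v₀ < ⋯ < vₙ}` is sent to `∑ j, (-1) ^ j • {v₀, …, vₙ} \ {vⱼ}`. In particular a
single vertex is sent to the empty set (augmentation), and the empty set to zero. -/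
noncomputable def boundaryMap : (Finset V →₀ F) →ₗ[F] (Finset V →₀ F) :=
  Finsupp.linearCombination F fun σ : Finset V =>
    ∑ v ∈ σ, Finsupp.single (σ.erase v) ((-1 : F) ^ (σ.filter (· < v)).card)

/-- The augmented simplicial chains of degree `i`: the free module on the faces of dimension `i`,
the empty face having dimension `-1`. -/
noncomputable def chains (K : PreAbstractSimplicialComplex V) (i : ℤ) :
    Submodule F (Finset V →₀ F) :=
  Finsupp.supported F F {σ | K.IsFace σ ∧ (σ.card : ℤ) - 1 = i}

/-- The cycles of degree `i`. -/
noncomputable def cycles (K : PreAbstractSimplicialComplex V) (i : ℤ) :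
    Submodule F (Finset V →₀ F) :=
  K.chains F i ⊓ LinearMap.ker (boundaryMap F)

/-- The boundaries of degree `i`: the images of the chains of degree `i + 1`. -/
noncomputable def boundaries (K : PreAbstractSimplicialComplex V) (i : ℤ) :
    Submodule F (Finset V →₀ F) :=
  (K.chains F (i + 1)).map (boundaryMap F)

theorem boundaryMap_single (σ : Finset V) (a : F) :
    boundaryMap F (Finsupp.single σ a) =
      a • ∑ v ∈ σ, Finsupp.single (σ.erase v) ((-1 : F) ^ (σ.filter (· < v)).card) := by
  simp [boundaryMap, Finsupp.linearCombination_single]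

theorem boundaryMap_boundaryMap (x : Finset V →₀ F) : boundaryMap F (boundaryMap F x) = 0 := by
  have key : ∀ (σ : Finset V) (v w : V), v ∈ σ → w ∈ σ → v < w →
      (-1 : F) ^ (σ.filter (· < v)).card * (-1) ^ ((σ.erase v).filter (· < w)).card +
        (-1) ^ (σ.filter (· < w)).card * (-1) ^ ((σ.erase w).filter (· < v)).card = 0 := by
    intro σ v w hv hw hvw
    have h1 : (σ.erase w).filter (· < v) = σ.filter (· < v) := by
      ext u
      simp only [Finset.mem_filter, Finset.mem_erase]
      constructor
      · tauto
      · rintro ⟨h, h'⟩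
        exact ⟨⟨(h'.trans hvw).ne, h⟩, h'⟩
    have h2 : (σ.filter (· < w)).card = ((σ.erase v).filter (· < w)).card + 1 := by
      rw [Finset.filter_erase, Finset.card_erase_add_one]
      simp [hv, hvw]
    rw [h1, h2]
    ring
  induction x using Finsupp.induction_linear with
  | zero => simp
  | add x y hx hy => simp [hx, hy]
  | single σ a =>
    rw [boundaryMap_single, map_smul, map_sum]
    convert smul_zero a
    simp only [boundaryMap_single, Finset.smul_sum, Finsupp.smul_single, smul_eq_mul]
    rw [Finset.sum_sigma']
    refine Finset.sum_involution (fun p _ => ⟨p.2, p.1⟩) ?_ ?_ ?_ ?_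
    · rintro ⟨v, w⟩ h
      simp only [Finset.mem_sigma, Finset.mem_erase] at h
      obtain ⟨hv, hwv, hw⟩ := h
      rw [Finset.erase_right_comm, ← Finsupp.single_add]
      rcases lt_or_gt_of_ne hwv with h | h
      · rw [add_comm, key σ w v hw hv h, Finsupp.single_zero]
      · rw [key σ v w hv hw h, Finsupp.single_zero]
    · rintro ⟨v, w⟩ h _ heq
      simp only [Finset.mem_sigma, Finset.mem_erase] at h
      simp only [Sigma.mk.injEq] at heq
      exact h.2.1 heq.1
    · rintro ⟨v, w⟩ h
      simp only [Finset.mem_sigma, Finset.mem_erase] at h ⊢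
      exact ⟨h.2.2, h.2.1.symm, h.1⟩
    · rintro ⟨v, w⟩ h
      rfl

/-- Boundaries are cycles, so `reducedHomology` below is the homology of a chain complex. -/
theorem boundaries_le_cycles (K : PreAbstractSimplicialComplex V) (i : ℤ) :
    K.boundaries F i ≤ K.cycles F i := by
  rintro _ ⟨x, hx, rfl⟩
  refine ⟨?_, boundaryMap_boundaryMap F x⟩
  have hx' := hx
  rw [SetLike.mem_coe, chains, Finsupp.mem_supported] at hx'
  rw [SetLike.mem_coe, boundaryMap, Finsupp.linearCombination_apply]
  refine Submodule.sum_mem _ fun σ hσ => Submodule.smul_mem _ _ (Submodule.sum_mem _ fun v hv => ?_)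
  obtain ⟨hf, hc⟩ := hx' hσ
  refine Finsupp.single_mem_supported F _ ⟨hf.subset (Finset.erase_subset _ _), ?_⟩
  have := Finset.card_erase_add_one hv
  omega

/-- The reduced simplicial homology module of `K` in degree `i` with coefficients in `F`:
cycles modulo boundaries. -/
abbrev reducedHomology (K : PreAbstractSimplicialComplex V) (i : ℤ) : Type _ :=
  SubmoduleQuotient (K.cycles F i) (K.boundaries F i)

theorem subsingleton_reducedHomology_iff (K : PreAbstractSimplicialComplex V) (i : ℤ) :
    Subsingleton (K.reducedHomology F i) ↔ K.cycles F i ≤ K.boundaries F i :=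
  subsingleton_submoduleQuotient_iff _ _

/-- A finite-dimensional complex is Cohen-Macaulay over `F` if for every face `σ` (including the
empty one) the reduced homology of the link of `σ` vanishes below the dimension of the link. -/
def IsCohenMacaulay (K : PreAbstractSimplicialComplex V) : Prop :=
  ∀ σ, K.IsFace σ → ∀ i : ℤ, i < (K.link σ).dim → Subsingleton ((K.link σ).reducedHomology F i)

/-- The depth of a finite-dimensional complex over `F`: the largest `d` between `-1` and `dim K`
for which the `d`-skeleton is Cohen-Macaulay over `F`. -/
noncomputable def depth (K : PreAbstractSimplicialComplex V) : ℤ :=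
  sSup {d : ℤ | -1 ≤ d ∧ d ≤ K.dim ∧ (K.skeleton d).IsCohenMacaulay F}

/-- The maximum that defines the depth exists. -/
theorem isGreatest_depth (K : PreAbstractSimplicialComplex V) (hK : K.FiniteDimensional) :
    IsGreatest {d : ℤ | -1 ≤ d ∧ d ≤ K.dim ∧ (K.skeleton d).IsCohenMacaulay F} (K.depth F) := by
  have hbdd : BddAbove {d : ℤ | -1 ≤ d ∧ d ≤ K.dim ∧ (K.skeleton d).IsCohenMacaulay F} :=
    ⟨K.dim, fun d hd => hd.2.1⟩
  refine ⟨Int.csSup_mem ⟨-1, le_rfl, ?_, ?_⟩ hbdd, fun d hd => le_csSup hbdd hd⟩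
  · exact le_csSup hK ⟨∅, Or.inl rfl, by simp⟩
  · intro σ hσ i hi
    have hfaces : ∀ τ, ((K.skeleton (-1)).link σ).IsFace τ → τ = ∅ := by
      rintro τ (rfl | ⟨hne, hf, -⟩)
      · rfl
      · rcases hf with h | ⟨-, h⟩
        · exact (Finset.union_eq_empty.1 h).1
        · have : (τ ∪ σ).card = 0 := by omega
          exact (Finset.union_eq_empty.1 (Finset.card_eq_zero.1 this)).1
    have hdim : ((K.skeleton (-1)).link σ).dim ≤ -1 := by
      refine csSup_le ⟨-1, ∅, Or.inl rfl, by simp⟩ ?_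
      rintro d ⟨τ, hτ, rfl⟩
      simp [hfaces τ hτ]
    have hcyc : ((K.skeleton (-1)).link σ).cycles F i = ⊥ := by
      have hemp : {τ : Finset V | ((K.skeleton (-1)).link σ).IsFace τ ∧
          (τ.card : ℤ) - 1 = i} = ∅ := by
        ext τ
        simp only [Set.mem_ofPred_eq, Set.mem_empty_iff_false, iff_false]
        rintro ⟨-, h⟩
        omega
      rw [cycles, chains, hemp, Finsupp.supported_empty, bot_inf_eq]
    rw [subsingleton_reducedHomology_iff, hcyc]
    exact bot_le

end Homology

end PreAbstractSimplicialComplex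

/-!
The proof replaces the depth by a condition on links in the complex itself: for a complex `K` of
finite dimension and `d ≥ -1`, one has `d ≤ depth K` if and only if, for every face `σ`, the reduced
homology of `link σ` vanishes in all degrees `i < d - |σ|` (`LinksAcyclicBelow`, `le_depth_iff`).
Indeed the link of `σ` in the `d`-skeleton is the `(d - |σ|)`-skeleton of `link σ`, which has the
same homology below degree `d - |σ|`. What has to be shown is that its dimension is exactly
`d - |σ|` when the `d`-skeleton is Cohen-Macaulay, i.e. that Cohen-Macaulay complexes are pure
(`IsCohenMacaulay.exists_superset_card_eq`).

The link of a face `σ ∪ τ` of a join is the join of the links (`link_join`), so the theorem reduces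
to two consequences of the Künneth formula over a field for the join of `A` and `B`:

* if the homology of `A` vanishes below `a` and that of `B` below `b`, then that of the join
  vanishes below `a + b + 1` (`cycles_join_le_boundaries`);
* if `A` has homology in degree `i` and `B` in degree `j`, then the join has homology in degree
  `i + j + 1` (`not_cycles_join_le_boundaries`).

For both, the chains of the join are identified with the tensor product of the chains of `A` and `B`
by the map `split` that cuts a face into its two parts, with the sign of the shuffle. Vanishing
follows by applying contracting homotopies of the two factors one after the other, and nonvanishing
by pairing the product of two cycles with the product of two cocycles. Since the condition
`LinksAcyclicBelow` for `d` fails exactly for `d > depth`, the first statement gives `≥` and the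
second `≤`.
-/

open scoped TensorProduct

/-- Over a field, a linear map has a linear section over the image of a submodule, with values in
that submodule. -/
theorem Submodule.exists_section_map {F M N : Type*} [Field F] [AddCommGroup M] [Module F M]
    [AddCommGroup N] [Module F N] (p : Submodule F M) (f : M →ₗ[F] N) :
    ∃ s : N →ₗ[F] M, ∀ y ∈ p.map f, s y ∈ p ∧ f (s y) = y := by
  obtain ⟨g, hg⟩ := (f.submoduleMap p).exists_rightInverse_of_surjective
    (LinearMap.range_eq_top.2 (f.submoduleMap_surjective p))
  obtain ⟨s, hs⟩ := LinearMap.exists_extend (p.subtype ∘ₗ g)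
  refine ⟨s, fun y hy => ?_⟩
  have h1 : s y = g ⟨y, hy⟩ := LinearMap.congr_fun hs ⟨y, hy⟩
  have h2 : f.submoduleMap p (g ⟨y, hy⟩) = ⟨y, hy⟩ := LinearMap.congr_fun hg ⟨y, hy⟩
  rw [h1]
  exact ⟨(g ⟨y, hy⟩).2, congrArg Subtype.val h2⟩

namespace PreAbstractSimplicialComplex

variable {V : Type*}

/-! ### Chains, contracting homotopies and cocycles -/

section Chains

variable (F : Type*) [Field F]

theorem chains_eq_span (K : PreAbstractSimplicialComplex V) (i : ℤ) :
    K.chains F i = Submodule.span F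
      ((fun σ => Finsupp.single σ (1 : F)) '' {σ | K.IsFace σ ∧ (σ.card : ℤ) - 1 = i}) := by
  rw [chains, Finsupp.supported_eq_span_single]

variable {F}

theorem single_mem_chains {K : PreAbstractSimplicialComplex V} {σ : Finset V} (hσ : K.IsFace σ)
    {i : ℤ} (hi : (σ.card : ℤ) - 1 = i) (c : F) : Finsupp.single σ c ∈ K.chains F i :=
  Finsupp.single_mem_supported F c ⟨hσ, hi⟩

/-- Linear maps that agree on the faces of dimension `i` agree on the chains of degree `i`. -/
theorem eqOn_chains {M : Type*} [AddCommGroup M] [Module F M]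
    {K : PreAbstractSimplicialComplex V} {i : ℤ} {f g : (Finset V →₀ F) →ₗ[F] M}
    (h : ∀ σ, K.IsFace σ → (σ.card : ℤ) - 1 = i → f (Finsupp.single σ 1) = g (Finsupp.single σ 1))
    {x : Finset V →₀ F} (hx : x ∈ K.chains F i) : f x = g x := by
  rw [chains_eq_span] at hx
  refine LinearMap.eqOn_span ?_ hx
  rintro _ ⟨σ, ⟨h1, h2⟩, rfl⟩
  exact h σ h1 h2

theorem chains_eq_bot (K : PreAbstractSimplicialComplex V) {i : ℤ} (hi : i < -1) :
    K.chains F i = ⊥ := by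
  have : {σ : Finset V | K.IsFace σ ∧ (σ.card : ℤ) - 1 = i} = ∅ := by
    ext σ
    simp only [Set.mem_ofPred_eq, Set.mem_empty_iff_false, iff_false]
    rintro ⟨-, h⟩
    omega
  rw [chains, this, Finsupp.supported_empty]

variable [LinearOrder V]

theorem boundaryMap_mem_chains {K : PreAbstractSimplicialComplex V} {i : ℤ}
    {x : Finset V →₀ F} (hx : x ∈ K.chains F i) : boundaryMap F x ∈ K.chains F (i - 1) := by
  refine (K.boundaries_le_cycles F (i - 1) ⟨x, ?_, rfl⟩).1
  rwa [sub_add_cancel]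

/-- A complex whose reduced homology vanishes below degree `a` has a contracting homotopy below
degree `a`. It is extended by zero to the degrees from `a` on. -/
theorem exists_contracting_homotopy (K : PreAbstractSimplicialComplex V) (a : ℤ)
    (hK : ∀ i < a, K.cycles F i ≤ K.boundaries F i) :
    ∃ h : (Finset V →₀ F) →ₗ[F] (Finset V →₀ F),
      (∀ i, ∀ x ∈ K.chains F i, h x ∈ K.chains F (i + 1)) ∧
      (∀ i < a, ∀ x ∈ K.chains F i, boundaryMap F (h x) + h (boundaryMap F x) = x) ∧
      (∀ i, a ≤ i → ∀ x ∈ K.chains F i, h x = 0) := by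
  -- a linear section of the boundary map in every degree
  have hs : ∀ i, ∃ s : (Finset V →₀ F) →ₗ[F] (Finset V →₀ F),
      ∀ y ∈ K.boundaries F i, s y ∈ K.chains F (i + 1) ∧ boundaryMap F (s y) = y :=
    fun i => (K.chains F (i + 1)).exists_section_map (boundaryMap F)
  choose s hs using hs
  -- below degree `a`, `x - s (∂ x)` is a cycle, hence a boundary, and `s` lifts it
  let g : ℤ → (Finset V →₀ F) →ₗ[F] (Finset V →₀ F) := fun i =>
    if i < a then s i ∘ₗ (LinearMap.id - s (i - 1) ∘ₗ boundaryMap F) else 0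
  let h : (Finset V →₀ F) →ₗ[F] (Finset V →₀ F) :=
    Finsupp.linearCombination F fun σ => g ((σ.card : ℤ) - 1) (Finsupp.single σ 1)
  have hg : ∀ i, ∀ x ∈ K.chains F i, h x = g i x := by
    intro i x hx
    refine eqOn_chains (fun σ _ hi => ?_) hx
    simp [h, hi]
  have hbd : ∀ i, ∀ x ∈ K.chains F i, boundaryMap F x ∈ K.boundaries F (i - 1) :=
    fun i x hx => ⟨x, by rwa [sub_add_cancel], rfl⟩
  have hcyc : ∀ i < a, ∀ x ∈ K.chains F i,
      x - s (i - 1) (boundaryMap F x) ∈ K.boundaries F i := by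
    intro i hi x hx
    obtain ⟨h1, h2⟩ := hs (i - 1) _ (hbd i x hx)
    rw [sub_add_cancel] at h1
    refine hK i hi ⟨Submodule.sub_mem _ hx h1, ?_⟩
    rw [SetLike.mem_coe, LinearMap.mem_ker, map_sub, h2, sub_self]
  refine ⟨h, fun i x hx => ?_, fun i hi x hx => ?_, fun i hi x hx => ?_⟩
  · rw [hg i x hx]
    by_cases hi : i < a
    · simpa [g, hi] using (hs i _ (hcyc i hi x hx)).1
    · simp [g, hi]
  · rw [hg i x hx, hg (i - 1) _ (boundaryMap_mem_chains hx)]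
    have h1 := (hs i _ (hcyc i hi x hx)).2
    have hi' : i - 1 < a := by omega
    simp only [g, hi, hi', if_true, LinearMap.comp_apply, LinearMap.sub_apply, LinearMap.id_apply,
      boundaryMap_boundaryMap, map_zero, sub_zero]
    rw [h1, sub_add_cancel]
  · rw [hg i x hx]
    simp [g, not_lt.2 hi]

/-- A reduced homology class that does not vanish is detected by a cocycle. -/
theorem exists_cocycle (K : PreAbstractSimplicialComplex V) (i : ℤ)
    (hK : ¬ K.cycles F i ≤ K.boundaries F i) :
    ∃ z ∈ K.cycles F i, ∃ φ : (Finset V →₀ F) →ₗ[F] F, φ z ≠ 0 ∧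
      ∀ σ, K.IsFace σ → φ (boundaryMap F (Finsupp.single σ 1)) = 0 := by
  obtain ⟨z, hz, hzb⟩ := SetLike.not_le_iff_exists.1 hK
  obtain ⟨ψ, hψz, hψ⟩ := Submodule.exists_le_ker_of_notMem hzb
  -- `ψ` is only controlled in degree `i`, so it is cut off in the other degrees
  let φ : (Finset V →₀ F) →ₗ[F] F :=
    Finsupp.linearCombination F fun σ => if (σ.card : ℤ) - 1 = i then ψ (Finsupp.single σ 1) else 0
  have hφ : ∀ x ∈ K.chains F i, φ x = ψ x := fun x hx =>
    eqOn_chains (fun σ _ hi => by simp [φ, hi]) hx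
  have hφ' : ∀ j, j ≠ i → ∀ x ∈ K.chains F j, φ x = 0 := fun j hj x hx =>
    eqOn_chains (g := 0) (fun σ _ hi => by simp [φ, hi, hj]) hx
  refine ⟨z, hz, φ, by rwa [hφ z hz.1], fun σ hσ => ?_⟩
  have hc := single_mem_chains hσ (i := (σ.card : ℤ) - 1) rfl (1 : F)
  have hb := boundaryMap_mem_chains hc
  by_cases hi : (σ.card : ℤ) - 1 - 1 = i
  · rw [hi] at hb
    rw [hφ _ hb]
    exact hψ ⟨_, single_mem_chains hσ (by omega) 1, rfl⟩
  · exact hφ' _ hi _ hb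

end Chains

/-! ### Cutting faces into two parts -/

section Splitting

variable (F : Type*) [Field F]

/-- The linear map that multiplies a face `σ` by `(-1) ^ |σ|`. -/
noncomputable def gradingSign : (Finset V →₀ F) →ₗ[F] (Finset V →₀ F) :=
  Finsupp.linearCombination F fun σ => Finsupp.single σ ((-1 : F) ^ σ.card)

theorem gradingSign_single (σ : Finset V) (c : F) :
    gradingSign F (Finsupp.single σ c) = (-1 : F) ^ σ.card • Finsupp.single σ c := by
  simp [gradingSign, mul_comm]

variable {F} in
theorem gradingSign_of_mem_chains {K : PreAbstractSimplicialComplex V} {i : ℤ} {n : ℕ}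
    (hn : (n : ℤ) - 1 = i) {x : Finset V →₀ F} (hx : x ∈ K.chains F i) :
    gradingSign F x = (-1 : F) ^ n • x := by
  refine eqOn_chains (g := (-1 : F) ^ n • LinearMap.id) (fun σ _ hi => ?_) hx
  have : σ.card = n := by omega
  simp only [gradingSign_single, this, LinearMap.smul_apply, LinearMap.id_apply]

variable [LinearOrder V]

/-- The sign of the shuffle that sorts the elements of `τ` followed by those of `σ`: the parity of
the number of pairs `(t, s) ∈ τ × σ` with `s < t`. -/
def shuffleSign (τ σ : Finset V) : F :=
  (-1) ^ ∑ t ∈ τ, (σ.filter (· < t)).card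

theorem shuffleSign_mul_self (τ σ : Finset V) :
    shuffleSign F τ σ * shuffleSign F τ σ = 1 := by
  rw [shuffleSign, ← mul_pow]
  simp

theorem shuffleSign_erase_left {τ : Finset V} (σ : Finset V) {v : V} (hv : v ∈ τ) :
    shuffleSign F τ σ = (-1) ^ (σ.filter (· < v)).card * shuffleSign F (τ.erase v) σ := by
  rw [shuffleSign, shuffleSign, ← pow_add,
    Finset.add_sum_erase τ (fun t => (σ.filter (· < t)).card) hv]

theorem shuffleSign_erase_right (τ : Finset V) {σ : Finset V} {v : V} (hv : v ∈ σ) :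
    shuffleSign F τ σ = (-1) ^ (τ.filter (v < ·)).card * shuffleSign F τ (σ.erase v) := by
  rw [shuffleSign, shuffleSign, ← pow_add, Finset.card_filter, ← Finset.sum_add_distrib]
  congr 1
  refine Finset.sum_congr rfl fun t _ => ?_
  rw [Finset.filter_erase]
  split_ifs with h
  · rw [add_comm, Finset.card_erase_add_one (by simp [hv, h])]
  · rw [Finset.erase_eq_of_notMem (by simp [h]), zero_add]

/-- The differential of the tensor square of the complex of all finite subsets of `V`. -/
noncomputable def tensorBoundary :
    (Finset V →₀ F) ⊗[F] (Finset V →₀ F) →ₗ[F] (Finset V →₀ F) ⊗[F] (Finset V →₀ F) :=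
  TensorProduct.map (boundaryMap F) LinearMap.id +
    TensorProduct.map (gradingSign F) (boundaryMap F)

theorem tensorBoundary_tmul (x y : Finset V →₀ F) :
    tensorBoundary F (x ⊗ₜ[F] y) =
      boundaryMap F x ⊗ₜ[F] y + gradingSign F x ⊗ₜ[F] boundaryMap F y := by
  simp [tensorBoundary]

/-- The map `ρ ↦ ± (ρ ∩ P) ⊗ (ρ \ P)`; with the sign of the shuffle it is a chain map. -/
noncomputable def split (P : V → Prop) [DecidablePred P] :
    (Finset V →₀ F) →ₗ[F] (Finset V →₀ F) ⊗[F] (Finset V →₀ F) :=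
  Finsupp.linearCombination F fun ρ =>
    shuffleSign F (ρ.filter P) (ρ.filter (¬ P ·)) •
      (Finsupp.single (ρ.filter P) 1 ⊗ₜ[F] Finsupp.single (ρ.filter (¬ P ·)) 1)

variable (P : V → Prop) [DecidablePred P]

theorem split_single (ρ : Finset V) (c : F) :
    split F P (Finsupp.single ρ c) =
      c • shuffleSign F (ρ.filter P) (ρ.filter (¬ P ·)) •
      (Finsupp.single (ρ.filter P) 1 ⊗ₜ[F] Finsupp.single (ρ.filter (¬ P ·)) 1) := by
  simp [split]

theorem split_injective : Function.Injective (split F P) := by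
  let J : (Finset V →₀ F) ⊗[F] (Finset V →₀ F) →ₗ[F] (Finset V →₀ F) :=
    TensorProduct.lift (Finsupp.linearCombination F fun τ =>
      Finsupp.linearCombination F fun σ => Finsupp.single (τ ∪ σ) (shuffleSign F τ σ))
  have hJ : J ∘ₗ split F P = LinearMap.id := by
    ext1 ρ
    ext1
    simp [J, split_single, shuffleSign_mul_self, Finset.filter_union_filter_not_eq]
  exact Function.LeftInverse.injective (g := J) fun x => LinearMap.congr_fun hJ x

theorem split_boundaryMap (x : Finset V →₀ F) :
    split F P (boundaryMap F x) = tensorBoundary F (split F P x) := by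
  suffices h : split F P ∘ₗ boundaryMap F = tensorBoundary F ∘ₗ split F P from
    LinearMap.congr_fun h x
  ext1 ρ
  ext1
  simp only [LinearMap.comp_apply, Finsupp.lsingle_apply]
  rw [split_single, boundaryMap_single, one_smul, one_smul, map_smul, tensorBoundary_tmul,
    boundaryMap_single, boundaryMap_single, one_smul, one_smul, map_sum, gradingSign_single,
    ← Finset.sum_filter_add_sum_filter_not ρ P, TensorProduct.sum_tmul, TensorProduct.tmul_sum,
    smul_add, Finset.smul_sum, Finset.smul_sum]
  set τ := ρ.filter P with hτ
  set σ := ρ.filter (¬ P ·) with hσ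
  have hpos : ∀ v, (ρ.filter (· < v)).card
      = (τ.filter (· < v)).card + (σ.filter (· < v)).card := by
    intro v
    rw [hτ, hσ, Finset.filter_comm, Finset.filter_comm (p := (¬ P ·)),
      Finset.card_filter_add_card_filter_not]
  congr 1
  · refine Finset.sum_congr rfl fun v hv => ?_
    have hvP : P v := (Finset.mem_filter.1 hv).2
    have h1 : (ρ.erase v).filter P = τ.erase v := Finset.filter_erase ..
    have h2 : (ρ.erase v).filter (¬ P ·) = σ := by
      rw [Finset.filter_erase, Finset.erase_eq_of_notMem (by simp [hvP])]
    rw [split_single, h1, h2, shuffleSign_erase_left F σ hv, hpos, pow_add,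
      ← mul_one ((-1 : F) ^ (τ.filter (· < v)).card), ← smul_eq_mul _ (1 : F),
      ← Finsupp.smul_single, ← TensorProduct.smul_tmul', smul_smul, smul_smul, smul_eq_mul,
      mul_one]
    congr 1
    ring
  · refine Finset.sum_congr rfl fun v hv => ?_
    have hvP : ¬ P v := (Finset.mem_filter.1 hv).2
    have h1 : (ρ.erase v).filter P = τ := by
      rw [Finset.filter_erase, Finset.erase_eq_of_notMem (by simp [hvP])]
    have h2 : (ρ.erase v).filter (¬ P ·) = σ.erase v := Finset.filter_erase ..
    have hcard : τ.card = (τ.filter (· < v)).card + (τ.filter (v < ·)).card := by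
      rw [← Finset.card_filter_add_card_filter_not (s := τ) (· < v)]
      congr 2
      refine Finset.filter_congr fun t ht => ?_
      have : t ≠ v := fun h => hvP (h ▸ (Finset.mem_filter.1 ht).2)
      simp only [not_lt]
      exact ⟨fun h => lt_of_le_of_ne h this.symm, le_of_lt⟩
    have hsq : ((-1 : F) ^ (τ.filter (v < ·)).card) * (-1) ^ (τ.filter (v < ·)).card = 1 := by
      rw [← mul_pow]
      simp
    rw [split_single, h1, h2, shuffleSign_erase_right F τ hv, hpos, pow_add, hcard, pow_add,
      ← mul_one ((-1 : F) ^ (σ.filter (· < v)).card), ← smul_eq_mul _ (1 : F),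
      ← Finsupp.smul_single, TensorProduct.tmul_smul, ← TensorProduct.smul_tmul', smul_smul,
      smul_smul, smul_smul, smul_eq_mul, mul_one]
    congr 1
    linear_combination (-(-1 : F) ^ (τ.filter (· < v)).card * (-1) ^ (σ.filter (· < v)).card *
      shuffleSign F τ (σ.erase v)) * hsq

end Splitting

/-! ### Homology of joins -/

section Kunneth

variable {F : Type*} [Field F]

/-- The part of total degree `k` of the tensor product of the chains of `A` and `B`, where
`τ ⊗ σ` has the degree of `τ ∪ σ` as a face of the join. Only the terms whose left factor has
dimension at least `a` are kept; `a = -1` is no restriction. -/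
noncomputable def tensorChains (F : Type*) [Field F] (A B : PreAbstractSimplicialComplex V)
    (a k : ℤ) : Submodule F ((Finset V →₀ F) ⊗[F] (Finset V →₀ F)) :=
  Submodule.span F {t | ∃ τ σ, A.IsFace τ ∧ B.IsFace σ ∧ a ≤ (τ.card : ℤ) - 1 ∧
    (τ.card : ℤ) + σ.card - 1 = k ∧ t = Finsupp.single τ 1 ⊗ₜ[F] Finsupp.single σ 1}

variable {A B : PreAbstractSimplicialComplex V}

theorem tmul_mem_tensorChains {a i j k : ℤ} (hi : a ≤ i) (hk : i + j + 1 = k)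
    {x y : Finset V →₀ F} (hx : x ∈ A.chains F i) (hy : y ∈ B.chains F j) :
    x ⊗ₜ[F] y ∈ tensorChains F A B a k := by
  rw [chains_eq_span] at hx hy
  have h := Submodule.apply_mem_map₂ (TensorProduct.mk F _ _) hx hy
  rw [Submodule.map₂_span_span] at h
  refine Submodule.span_mono ?_ h
  rintro _ ⟨_, ⟨τ, ⟨hτ, hτi⟩, rfl⟩, _, ⟨σ, ⟨hσ, hσj⟩, rfl⟩, rfl⟩
  exact ⟨τ, σ, hτ, hσ, by omega, by omega, rfl⟩

theorem mem_of_mem_tensorChains {a k : ℤ} {M : Type*} [AddCommMonoid M] [Module F M]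
    (f : (Finset V →₀ F) ⊗[F] (Finset V →₀ F) →ₗ[F] M) (N : Submodule F M)
    (h : ∀ τ σ, A.IsFace τ → B.IsFace σ → a ≤ (τ.card : ℤ) - 1 → (τ.card : ℤ) + σ.card - 1 = k →
      f (Finsupp.single τ 1 ⊗ₜ[F] Finsupp.single σ 1) ∈ N)
    {t : (Finset V →₀ F) ⊗[F] (Finset V →₀ F)} (ht : t ∈ tensorChains F A B a k) : f t ∈ N := by
  have : tensorChains F A B a k ≤ N.comap f := by
    refine Submodule.span_le.2 ?_
    rintro _ ⟨τ, σ, h1, h2, h3, h4, rfl⟩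
    exact h τ σ h1 h2 h3 h4
  exact this ht

/-- Linear maps that agree on the products of faces agree on all tensor chains. -/
theorem eqOn_tensorChains {a k : ℤ} {M : Type*} [AddCommMonoid M] [Module F M]
    {f g : (Finset V →₀ F) ⊗[F] (Finset V →₀ F) →ₗ[F] M}
    (h : ∀ τ σ, A.IsFace τ → B.IsFace σ → a ≤ (τ.card : ℤ) - 1 → (τ.card : ℤ) + σ.card - 1 = k →
      f (Finsupp.single τ 1 ⊗ₜ[F] Finsupp.single σ 1) =
        g (Finsupp.single τ 1 ⊗ₜ[F] Finsupp.single σ 1))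
    {t : (Finset V →₀ F) ⊗[F] (Finset V →₀ F)} (ht : t ∈ tensorChains F A B a k) : f t = g t := by
  refine LinearMap.eqOn_span ?_ ht
  rintro _ ⟨τ, σ, h1, h2, h3, h4, rfl⟩
  exact h τ σ h1 h2 h3 h4

variable [LinearOrder V]

section Split

variable {P : V → Prop} [DecidablePred P]

/-- If `P` separates the vertices of `A` from those of `B`, the splitting map sends the chains of
the join onto the tensor product of the chains of `A` and `B`. -/
theorem map_split_chains_join (hA : ∀ τ, A.IsFace τ → ∀ v ∈ τ, P v)
    (hB : ∀ σ, B.IsFace σ → ∀ v ∈ σ, ¬ P v) (k : ℤ) :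
    ((A.join B).chains F k).map (split F P) = tensorChains F A B (-1) k := by
  have hl : ∀ τ σ, A.IsFace τ → B.IsFace σ → (τ ∪ σ).filter P = τ := by
    intro τ σ hτ hσ
    rw [Finset.filter_union, Finset.filter_true_of_mem (hA τ hτ),
      Finset.filter_false_of_mem (hB σ hσ), Finset.union_empty]
  have hr : ∀ τ σ, A.IsFace τ → B.IsFace σ → (τ ∪ σ).filter (¬ P ·) = σ := by
    intro τ σ hτ hσ
    rw [Finset.filter_union, Finset.filter_true_of_mem (hB σ hσ),
      Finset.filter_false_of_mem (fun v hv => not_not.2 (hA τ hτ v hv)), Finset.empty_union]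
  have hc : ∀ τ σ, A.IsFace τ → B.IsFace σ → (τ ∪ σ).card = τ.card + σ.card := fun τ σ hτ hσ =>
    Finset.card_union_of_disjoint
      (Finset.disjoint_left.2 fun v hv hv' => hB σ hσ v hv' (hA τ hτ v hv))
  refine le_antisymm ?_ (Submodule.span_le.2 ?_)
  · rw [chains_eq_span, Submodule.map_span, Submodule.span_le]
    rintro _ ⟨_, ⟨ρ, ⟨hρ, hk⟩, rfl⟩, rfl⟩
    obtain ⟨τ, σ, hτ, hσ, rfl⟩ : ∃ τ σ, A.IsFace τ ∧ B.IsFace σ ∧ ρ = τ ∪ σ := by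
      rcases hρ with rfl | ⟨-, h⟩
      · exact ⟨∅, ∅, Or.inl rfl, Or.inl rfl, rfl⟩
      · exact h
    rw [hc τ σ hτ hσ] at hk
    simp only [split_single, hl τ σ hτ hσ, hr τ σ hτ hσ]
    refine Submodule.smul_mem _ _ (Submodule.smul_mem _ _ (Submodule.subset_span ?_))
    exact ⟨τ, σ, hτ, hσ, by omega, by omega, rfl⟩
  · rintro _ ⟨τ, σ, hτ, hσ, -, hk, rfl⟩
    have hρ : (A.join B).IsFace (τ ∪ σ) := by
      rcases (τ ∪ σ).eq_empty_or_nonempty with h | h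
      · exact Or.inl h
      · exact Or.inr ⟨h, τ, σ, hτ, hσ, rfl⟩
    refine ⟨Finsupp.single (τ ∪ σ) (shuffleSign F τ σ),
      single_mem_chains hρ (by rw [hc τ σ hτ hσ]; omega) _, ?_⟩
    rw [split_single, hl τ σ hτ hσ, hr τ σ hτ hσ, smul_smul, shuffleSign_mul_self, one_smul]

end Split

theorem gradingSign_boundaryMap (x : Finset V →₀ F) :
    gradingSign F (boundaryMap F x) = - boundaryMap F (gradingSign F x) := by
  rw [eq_neg_iff_add_eq_zero]
  suffices h : gradingSign F ∘ₗ boundaryMap F + boundaryMap F ∘ₗ gradingSign F = 0 by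
    rw [← LinearMap.comp_apply, ← LinearMap.comp_apply, ← LinearMap.add_apply, h,
      LinearMap.zero_apply]
  ext1 σ
  ext1
  simp only [LinearMap.comp_apply, LinearMap.add_apply, Finsupp.lsingle_apply,
    gradingSign_single, map_smul, LinearMap.zero_apply]
  rw [boundaryMap_single, one_smul, map_sum, Finset.smul_sum, ← Finset.sum_add_distrib]
  refine Finset.sum_eq_zero fun v hv => ?_
  rw [gradingSign_single, ← add_smul, ← Finset.card_erase_add_one hv, pow_succ, mul_neg_one,
    add_neg_cancel, zero_smul]

theorem tensorBoundary_tensorBoundary (t : (Finset V →₀ F) ⊗[F] (Finset V →₀ F)) :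
    tensorBoundary F (tensorBoundary F t) = 0 := by
  induction t with
  | zero => simp
  | add x y hx hy => rw [map_add, map_add, hx, hy, add_zero]
  | tmul x y =>
    simp only [tensorBoundary_tmul, map_add, boundaryMap_boundaryMap, TensorProduct.zero_tmul,
      TensorProduct.tmul_zero, gradingSign_boundaryMap, TensorProduct.neg_tmul]
    abel

/-- If the reduced homology of `A` vanishes below degree `a` and that of `B` below degree `b`, then
every cycle of degree less than `a + b + 1` in the tensor product is a boundary. The contracting
homotopy of `A` moves the cycle into left dimensions `≥ a`, hence right dimensions `< b`,
where the contracting homotopy of `B` fills it. -/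
theorem exists_tensorBoundary_eq {a b k : ℤ} (hA : ∀ i < a, A.cycles F i ≤ A.boundaries F i)
    (hB : ∀ j < b, B.cycles F j ≤ B.boundaries F j) (hk : k < a + b + 1)
    {t : (Finset V →₀ F) ⊗[F] (Finset V →₀ F)} (ht : t ∈ tensorChains F A B (-1) k)
    (htc : tensorBoundary F t = 0) :
    ∃ y ∈ tensorChains F A B (-1) (k + 1), tensorBoundary F y = t := by
  obtain ⟨f, hf1, hf2, hf3⟩ := A.exists_contracting_homotopy a hA
  obtain ⟨g, hg1, hg2, -⟩ := B.exists_contracting_homotopy b hB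
  let H₁ := TensorProduct.map f (LinearMap.id (R := F) (M := Finset V →₀ F))
  let H₂ := TensorProduct.map (gradingSign (V := V) F) g
  let D := tensorBoundary F (V := V)
  have c1 : ∀ σ : Finset V, ∀ K : PreAbstractSimplicialComplex V, K.IsFace σ →
      Finsupp.single σ (1 : F) ∈ K.chains F ((σ.card : ℤ) - 1) :=
    fun σ K hσ => single_mem_chains hσ rfl 1
  have h1 : H₁ t ∈ tensorChains F A B (-1) (k + 1) := by
    refine mem_of_mem_tensorChains H₁ _ (fun τ σ hτ hσ _ h => ?_) ht
    exact tmul_mem_tensorChains (by omega) (by omega) (hf1 _ _ (c1 τ A hτ)) (c1 σ B hσ)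
  -- the chain map homotopic to the identity through `f`, on the left factor
  let Q : (Finset V →₀ F) ⊗[F] (Finset V →₀ F) →ₗ[F] (Finset V →₀ F) ⊗[F] (Finset V →₀ F) :=
    LinearMap.id + (-1 : F) • (D ∘ₗ H₁ + H₁ ∘ₗ D)
  have hcancel : ∀ x : (Finset V →₀ F) ⊗[F] (Finset V →₀ F), x + (-1 : F) • x = 0 := by
    intro x
    nth_rw 1 [← one_smul F x]
    rw [← add_smul, add_neg_cancel, zero_smul]
  have h2 : Q t ∈ tensorChains F A B a k := by
    refine mem_of_mem_tensorChains _ _ (fun τ σ hτ hσ _ h => ?_) ht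
    have hs := gradingSign_of_mem_chains (n := τ.card) rfl (c1 τ A hτ)
    simp only [Q, LinearMap.add_apply, LinearMap.smul_apply, LinearMap.comp_apply,
      LinearMap.id_apply, H₁, D, TensorProduct.map_tmul, tensorBoundary_tmul, map_add, hs, map_smul]
    rcases lt_or_ge ((τ.card : ℤ) - 1) a with ha | ha
    · have hs' := gradingSign_of_mem_chains (n := τ.card + 1) (by push_cast; ring)
        (hf1 _ _ (c1 τ A hτ))
      rw [hs', add_add_add_comm, ← TensorProduct.add_tmul, ← TensorProduct.add_tmul,
        hf2 _ ha _ (c1 τ A hτ), ← add_smul, pow_succ, mul_neg_one, neg_add_cancel, zero_smul,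
        TensorProduct.zero_tmul, add_zero, hcancel]
      exact Submodule.zero_mem _
    · rw [hf3 _ ha _ (c1 τ A hτ)]
      simp only [map_zero, smul_zero, TensorProduct.zero_tmul, add_zero, zero_add]
      refine Submodule.add_mem _ (tmul_mem_tensorChains ha (by omega) (c1 τ A hτ) (c1 σ B hσ))
        (Submodule.smul_mem _ _ ?_)
      have := hf1 _ _ (boundaryMap_mem_chains (c1 τ A hτ))
      rw [sub_add_cancel] at this
      exact tmul_mem_tensorChains ha (by omega) this (c1 σ B hσ)
  set t' := Q t with ht'
  have ht'' : t' = t + (-1 : F) • D (H₁ t) := by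
    have : D t = 0 := htc
    simp only [ht', Q, LinearMap.add_apply, LinearMap.smul_apply, LinearMap.comp_apply,
      LinearMap.id_apply, this, map_zero, add_zero]
  have hDt' : D t' = 0 := by
    rw [ht'', map_add, map_smul]
    simp only [D, htc, tensorBoundary_tensorBoundary, smul_zero, add_zero]
  have h3 : H₂ t' ∈ tensorChains F A B (-1) (k + 1) := by
    refine mem_of_mem_tensorChains H₂ _ (fun τ σ hτ hσ _ h => ?_) h2
    simp only [H₂, TensorProduct.map_tmul, gradingSign_single]
    exact tmul_mem_tensorChains (by omega) (by omega) (Submodule.smul_mem _ _ (c1 τ A hτ))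
      (hg1 _ _ (c1 σ B hσ))
  -- below degree `b` on the right, `H₂` is a contracting homotopy
  have h4 : (D ∘ₗ H₂ + H₂ ∘ₗ D) t' = (LinearMap.id : _ →ₗ[F] _) t' := by
    refine eqOn_tensorChains (fun τ σ hτ hσ ha h => ?_) h2
    have hb : (σ.card : ℤ) - 1 < b := by omega
    have hh := hg2 _ hb _ (c1 σ B hσ)
    have hs := gradingSign_of_mem_chains (n := τ.card) rfl (c1 τ A hτ)
    have hsq : ((-1 : F) ^ τ.card) * (-1) ^ τ.card = 1 := by
      rw [← mul_pow]
      simp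
    have hgg : gradingSign F (gradingSign F (Finsupp.single τ (1 : F))) = Finsupp.single τ 1 := by
      rw [hs, map_smul, hs, smul_smul, hsq, one_smul]
    simp only [LinearMap.add_apply, LinearMap.comp_apply,
      LinearMap.id_apply, H₂, D, TensorProduct.map_tmul, tensorBoundary_tmul, map_add, hgg,
      gradingSign_boundaryMap, TensorProduct.neg_tmul]
    nth_rw 5 [← hh]
    rw [TensorProduct.tmul_add]
    abel
  refine ⟨H₁ t + H₂ t', Submodule.add_mem _ h1 h3, ?_⟩
  simp only [LinearMap.add_apply, LinearMap.comp_apply, LinearMap.id_apply, hDt', map_zero,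
    add_zero] at h4
  change D (H₁ t + H₂ t') = t
  rw [map_add, h4, ht'', add_left_comm, hcancel, add_zero]

variable {P : V → Prop}

/-- The join of a complex without reduced homology below degree `a` and one without reduced
homology below degree `b` has no reduced homology below degree `a + b + 1`. -/
theorem cycles_join_le_boundaries (hPA : ∀ τ, A.IsFace τ → ∀ v ∈ τ, P v)
    (hPB : ∀ σ, B.IsFace σ → ∀ v ∈ σ, ¬ P v)
    {a b k : ℤ} (hA : ∀ i < a, A.cycles F i ≤ A.boundaries F i)
    (hB : ∀ j < b, B.cycles F j ≤ B.boundaries F j) (hk : k < a + b + 1) :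
    (A.join B).cycles F k ≤ (A.join B).boundaries F k := by
  classical
  rintro z ⟨hz, hz0⟩
  rw [SetLike.mem_coe, LinearMap.mem_ker] at hz0
  have h1 : split F P z ∈ tensorChains F A B (-1) k :=
    map_split_chains_join (F := F) hPA hPB k ▸ Submodule.mem_map_of_mem hz
  obtain ⟨y, hy, hyz⟩ := exists_tensorBoundary_eq hA hB hk h1
    (by rw [← split_boundaryMap, hz0, map_zero])
  rw [← map_split_chains_join (F := F) hPA hPB] at hy
  obtain ⟨x, hx, rfl⟩ := hy
  rw [← split_boundaryMap] at hyz
  exact ⟨x, hx, split_injective F P hyz⟩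

/-- If `A` has reduced homology in degree `i` and `B` has reduced homology in degree `j`, then the
join has reduced homology in degree `i + j + 1`: the product of the two cycles is not a boundary,
because the product of the cocycles that detect them does not vanish on it. -/
theorem not_cycles_join_le_boundaries (hPA : ∀ τ, A.IsFace τ → ∀ v ∈ τ, P v)
    (hPB : ∀ σ, B.IsFace σ → ∀ v ∈ σ, ¬ P v)
    {i j : ℤ} (hA : ¬ A.cycles F i ≤ A.boundaries F i)
    (hB : ¬ B.cycles F j ≤ B.boundaries F j) :
    ¬ (A.join B).cycles F (i + j + 1) ≤ (A.join B).boundaries F (i + j + 1) := by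
  classical
  intro hle
  obtain ⟨z, ⟨hz, hz0⟩, φ, hφz, hφ⟩ := A.exists_cocycle i hA
  obtain ⟨w, ⟨hw, hw0⟩, ψ, hψw, hψ⟩ := B.exists_cocycle j hB
  rw [SetLike.mem_coe, LinearMap.mem_ker] at hz0 hw0
  have hi : -1 ≤ i := by
    by_contra! hi
    rw [chains_eq_bot A hi, SetLike.mem_coe, Submodule.mem_bot] at hz
    exact hφz (by rw [hz, map_zero])
  have hzw : z ⊗ₜ[F] w ∈ tensorChains F A B (-1) (i + j + 1) :=
    tmul_mem_tensorChains hi rfl hz hw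
  rw [← map_split_chains_join (F := F) hPA hPB] at hzw
  obtain ⟨x, hx, hxzw⟩ := hzw
  have hx0 : boundaryMap F x = 0 := by
    apply split_injective F P
    rw [split_boundaryMap, hxzw, tensorBoundary_tmul, hz0, hw0, map_zero, TensorProduct.zero_tmul,
      TensorProduct.tmul_zero, add_zero]
  obtain ⟨y, hy, rfl⟩ := hle ⟨hx, hx0⟩
  have hy' : split F P y ∈ tensorChains F A B (-1) (i + j + 1 + 1) :=
    map_split_chains_join (F := F) hPA hPB _ ▸ Submodule.mem_map_of_mem hy
  let Φ : (Finset V →₀ F) ⊗[F] (Finset V →₀ F) →ₗ[F] F :=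
    LinearMap.mul' F F ∘ₗ TensorProduct.map φ ψ
  have hΦ : (Φ ∘ₗ tensorBoundary F) (split F P y) = (0 : _ →ₗ[F] F) (split F P y) := by
    refine eqOn_tensorChains (fun τ σ hτ hσ _ _ => ?_) hy'
    simp [Φ, tensorBoundary_tmul, hφ τ hτ, hψ σ hσ]
  rw [split_boundaryMap] at hxzw
  rw [LinearMap.comp_apply, hxzw, LinearMap.zero_apply] at hΦ
  simp only [Φ, LinearMap.comp_apply, TensorProduct.map_tmul, LinearMap.mul'_apply] at hΦ
  exact mul_ne_zero hφz hψw hΦ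

end Kunneth

/-! ### Faces, links and joins -/

section Faces

variable {K L : PreAbstractSimplicialComplex V} {σ τ : Finset V}

theorem isFace_skeleton {d : ℤ} (hd : -1 ≤ d) :
    (K.skeleton d).IsFace σ ↔ K.IsFace σ ∧ (σ.card : ℤ) - 1 ≤ d := by
  constructor
  · rintro (rfl | ⟨h1, h2⟩)
    · exact ⟨Or.inl rfl, by simpa using hd⟩
    · exact ⟨Or.inr h1, h2⟩
  · rintro ⟨rfl | h1, h2⟩
    · exact Or.inl rfl
    · exact Or.inr ⟨h1, h2⟩

theorem FiniteDimensional.card_le_dim (hK : K.FiniteDimensional) (hσ : K.IsFace σ) :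
    (σ.card : ℤ) - 1 ≤ K.dim :=
  le_csSup hK ⟨σ, hσ, rfl⟩

theorem FiniteDimensional.exists_card_eq_dim (hK : K.FiniteDimensional) :
    ∃ σ, K.IsFace σ ∧ (σ.card : ℤ) - 1 = K.dim := by
  obtain ⟨σ, hσ, h⟩ := Int.csSup_mem
    (s := {d : ℤ | ∃ σ, K.IsFace σ ∧ d = (σ.card : ℤ) - 1}) ⟨-1, ∅, Or.inl rfl, by simp⟩ hK
  exact ⟨σ, hσ, h.symm⟩

theorem dim_le {m : ℤ} (h : ∀ σ, K.IsFace σ → (σ.card : ℤ) - 1 ≤ m) : K.dim ≤ m := by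
  refine csSup_le ⟨-1, ∅, Or.inl rfl, by simp⟩ ?_
  rintro d ⟨σ, hσ, rfl⟩
  exact h σ hσ

theorem dim_eq {m : ℤ} (h : ∀ σ, K.IsFace σ → (σ.card : ℤ) - 1 ≤ m) (hτ : K.IsFace τ)
    (hm : (τ.card : ℤ) - 1 = m) : K.dim = m := by
  refine le_antisymm (dim_le h) (hm ▸ le_csSup ⟨m, ?_⟩ ⟨τ, hτ, rfl⟩)
  rintro d ⟨σ, hσ, rfl⟩
  exact h σ hσ

theorem IsFace.mem_vertices (hσ : K.IsFace σ) {v : V} (hv : v ∈ σ) : v ∈ K.vertices := by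
  rcases hσ.subset (Finset.singleton_subset_iff.2 hv) with h | h
  · exact absurd h (Finset.singleton_ne_empty v)
  · exact h

variable [DecidableEq V]

theorem isFace_link (hσ : K.IsFace σ) :
    (K.link σ).IsFace τ ↔ K.IsFace (τ ∪ σ) ∧ Disjoint τ σ := by
  constructor
  · rintro (rfl | ⟨-, h⟩)
    · simpa using hσ
    · exact h
  · rintro h
    rcases τ.eq_empty_or_nonempty with h0 | h0
    · exact Or.inl h0
    · exact Or.inr ⟨h0, h⟩

theorem link_empty : K.link ∅ = K := by
  ext τ
  change τ.Nonempty ∧ K.IsFace (τ ∪ ∅) ∧ Disjoint τ ∅ ↔ τ ∈ K.faces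
  rw [Finset.union_empty]
  constructor
  · rintro ⟨h0, h | h, -⟩
    · exact absurd h h0.ne_empty
    · exact h
  · exact fun h => ⟨(K.isRelLowerSet_faces h).1, Or.inr h, Finset.disjoint_empty_right _⟩

theorem link_link (hσ : K.IsFace σ) (h : Disjoint τ σ) :
    (K.link σ).link τ = K.link (τ ∪ σ) := by
  ext ρ
  change ρ.Nonempty ∧ (K.link σ).IsFace (ρ ∪ τ) ∧ Disjoint ρ τ ↔
    ρ.Nonempty ∧ K.IsFace (ρ ∪ (τ ∪ σ)) ∧ Disjoint ρ (τ ∪ σ)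
  rw [isFace_link hσ, Finset.union_assoc, Finset.disjoint_union_left, Finset.disjoint_union_right]
  tauto

theorem isFace_join : (K.join L).IsFace σ ↔ ∃ α β, K.IsFace α ∧ L.IsFace β ∧ σ = α ∪ β := by
  constructor
  · rintro (rfl | ⟨-, h⟩)
    · exact ⟨∅, ∅, Or.inl rfl, Or.inl rfl, rfl⟩
    · exact h
  · intro h
    rcases σ.eq_empty_or_nonempty with h0 | h0
    · exact Or.inl h0
    · exact Or.inr ⟨h0, h⟩

theorem FiniteDimensional.join (hK : K.FiniteDimensional) (hL : L.FiniteDimensional) :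
    (K.join L).FiniteDimensional := by
  refine ⟨K.dim + L.dim + 1, ?_⟩
  rintro d ⟨ρ, hρ, rfl⟩
  obtain ⟨α, β, hα, hβ, rfl⟩ := isFace_join.1 hρ
  have h1 := hK.card_le_dim hα
  have h2 := hL.card_le_dim hβ
  have h3 := Finset.card_union_le α β
  omega

/-- The link of a face of a join is the join of the links. -/
theorem link_join (hKL : Disjoint K.vertices L.vertices) (hσ : K.IsFace σ) (hτ : L.IsFace τ) :
    (K.join L).link (σ ∪ τ) = (K.link σ).join (L.link τ) := by
  have hd : ∀ α β, K.IsFace α → L.IsFace β → Disjoint α β := fun α β hα hβ =>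
    Finset.disjoint_left.2 fun v h1 h2 =>
      Set.disjoint_left.1 hKL (hα.mem_vertices h1) (hβ.mem_vertices h2)
  ext ρ
  change ρ.Nonempty ∧ (K.join L).IsFace (ρ ∪ (σ ∪ τ)) ∧ Disjoint ρ (σ ∪ τ) ↔
    ρ.Nonempty ∧ ∃ α β, (K.link σ).IsFace α ∧ (L.link τ).IsFace β ∧ ρ = α ∪ β
  refine and_congr_right fun _ => ?_
  rw [Finset.disjoint_union_right, isFace_join]
  constructor
  · rintro ⟨⟨α, β, hα, hβ, h⟩, h1, h2⟩
    have hσα : σ ⊆ α := fun v hv => by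
      have : v ∈ α ∪ β := h ▸ by simp [hv]
      exact (Finset.mem_union.1 this).resolve_right (Finset.disjoint_left.1 (hd σ β hσ hβ) hv)
    have hτβ : τ ⊆ β := fun v hv => by
      have : v ∈ α ∪ β := h ▸ by simp [hv]
      exact (Finset.mem_union.1 this).resolve_left (Finset.disjoint_right.1 (hd α τ hα hτ) hv)
    refine ⟨ρ ∩ α, ρ ∩ β, (isFace_link hσ).2 ⟨?_, ?_⟩, (isFace_link hτ).2 ⟨?_, ?_⟩, ?_⟩
    · exact hα.subset (Finset.union_subset Finset.inter_subset_right hσα)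
    · exact Finset.disjoint_of_subset_left Finset.inter_subset_left h1
    · exact hβ.subset (Finset.union_subset Finset.inter_subset_right hτβ)
    · exact Finset.disjoint_of_subset_left Finset.inter_subset_left h2
    · rw [← Finset.inter_union_distrib_left, ← h]
      exact (Finset.inter_eq_left.2 Finset.subset_union_left).symm
  · rintro ⟨α, β, hα, hβ, rfl⟩
    rw [isFace_link hσ] at hα
    rw [isFace_link hτ] at hβ
    have hα' := hα.1.subset (Finset.subset_union_left (s₁ := α) (s₂ := σ))
    have hβ' := hβ.1.subset (Finset.subset_union_left (s₁ := β) (s₂ := τ))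
    refine ⟨⟨α ∪ σ, β ∪ τ, hα.1, hβ.1, Finset.union_union_union_comm ..⟩, ?_, ?_⟩
    · exact Finset.disjoint_union_left.2 ⟨hα.2, (hd σ β hσ hβ').symm⟩
    · exact Finset.disjoint_union_left.2 ⟨hd α τ hα' hτ, hβ.2⟩

end Faces

/-! ### Purity of Cohen-Macaulay complexes -/

section Purity

variable {F : Type*} [Field F] {K L : PreAbstractSimplicialComplex V}

theorem chains_congr {i : ℤ} (h : ∀ σ, (σ.card : ℤ) - 1 = i → (K.IsFace σ ↔ L.IsFace σ)) :
    K.chains F i = L.chains F i := by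
  have : {σ | K.IsFace σ ∧ (σ.card : ℤ) - 1 = i} = {σ | L.IsFace σ ∧ (σ.card : ℤ) - 1 = i} := by
    ext σ
    exact and_congr_left fun hi => h σ hi
  rw [chains, chains, this]

variable [LinearOrder V]

/-- Only the faces of dimension at most `i + 1` matter for the homology in degree `i`. -/
theorem cycles_le_boundaries_congr {i : ℤ}
    (h : ∀ σ, (σ.card : ℤ) - 1 ≤ i + 1 → (K.IsFace σ ↔ L.IsFace σ)) :
    K.cycles F i ≤ K.boundaries F i ↔ L.cycles F i ≤ L.boundaries F i := by
  have h1 : K.chains F i = L.chains F i := chains_congr fun σ hσ => h σ (by omega)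
  have h2 : K.chains F (i + 1) = L.chains F (i + 1) := chains_congr fun σ hσ => h σ (by omega)
  rw [cycles, cycles, boundaries, boundaries, h1, h2]

/-- If the reduced homology in degree `-1` vanishes, there is a vertex. -/
theorem exists_vertex (h : K.cycles F (-1) ≤ K.boundaries F (-1)) : ∃ v, K.IsFace {v} := by
  by_contra! hv
  have h0 : K.chains F (-1 + 1) = ⊥ := by
    have : {σ | K.IsFace σ ∧ (σ.card : ℤ) - 1 = -1 + 1} = ∅ := by
      ext σ
      simp only [Set.mem_ofPred_eq, Set.mem_empty_iff_false, iff_false]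
      rintro ⟨h1, h2⟩
      obtain ⟨v, rfl⟩ := Finset.card_eq_one.1 (show σ.card = 1 by omega)
      exact hv v h1
    rw [chains, this, Finsupp.supported_empty]
  have hmem : Finsupp.single (∅ : Finset V) (1 : F) ∈ K.cycles F (-1) := by
    refine ⟨single_mem_chains (Or.inl rfl) (by simp) 1, ?_⟩
    rw [SetLike.mem_coe, LinearMap.mem_ker, boundaryMap_single, Finset.sum_empty, smul_zero]
  obtain ⟨x, hx, hx1⟩ := h hmem
  rw [h0, SetLike.mem_coe, Submodule.mem_bot] at hx
  rw [hx, map_zero] at hx1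
  exact Finsupp.single_ne_zero.2 one_ne_zero hx1.symm

/-- If the reduced homology in degree `0` vanishes, a property of vertices that is inherited along
edges holds for all vertices as soon as it holds for one: the difference of two vertices is a
boundary, and the sum of the coefficients over a union of components vanishes on boundaries. -/
theorem forall_vertex_of_edge (h : K.cycles F 0 ≤ K.boundaries F 0) {S : V → Prop}
    (hS : ∀ x y, K.IsFace {x, y} → S x → S y) {u v : V} (hu : K.IsFace {u}) (hv : K.IsFace {v})
    (hSu : S u) : S v := by
  classical
  by_contra hSv
  let φ : (Finset V →₀ F) →ₗ[F] F :=
    Finsupp.linearCombination F fun τ => if ∃ x, τ = {x} ∧ S x then 1 else 0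
  have hφ : ∀ x (c : F), φ (Finsupp.single {x} c) = if S x then c else 0 := by
    intro x c
    have : (∃ y, ({x} : Finset V) = {y} ∧ S y) ↔ S x := by simp
    simp only [φ, Finsupp.linearCombination_single, this, smul_eq_mul, mul_ite, mul_one, mul_zero]
  have hedge : ∀ x y, x < y → K.IsFace {x, y} →
      φ (boundaryMap F (Finsupp.single {x, y} 1)) = 0 := by
    intro x y hxy hf
    have hSxy : S x ↔ S y := ⟨hS x y hf, hS y x (Finset.pair_comm x y ▸ hf)⟩
    have e1 : ({x, y} : Finset V).erase x = {y} := by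
      rw [Finset.erase_insert (by simpa using hxy.ne)]
    have e2 : ({x, y} : Finset V).erase y = {x} := by
      rw [Finset.pair_comm, Finset.erase_insert (by simpa using hxy.ne')]
    have e3 : ({x, y} : Finset V).filter (· < x) = ∅ := by
      simp [Finset.filter_insert, Finset.filter_singleton, hxy.le]
    have e4 : ({x, y} : Finset V).filter (· < y) = {x} := by
      simp [Finset.filter_insert, Finset.filter_singleton, hxy]
    rw [boundaryMap_single, one_smul, Finset.sum_pair hxy.ne, e1, e2, e3, e4, map_add, hφ, hφ]
    by_cases hx : S x <;> simp [← hSxy, hx]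
  have hcyc : Finsupp.single {u} (1 : F) - Finsupp.single {v} 1 ∈ K.cycles F 0 := by
    refine ⟨Submodule.sub_mem _ (single_mem_chains hu (by simp) 1)
      (single_mem_chains hv (by simp) 1), ?_⟩
    simp [LinearMap.mem_ker, boundaryMap_single, Finset.filter_singleton]
  obtain ⟨x, hx, hx1⟩ := h hcyc
  have h0 : (φ ∘ₗ boundaryMap F) x = (0 : _ →ₗ[F] F) x := by
    refine eqOn_chains (fun σ hσ hc => ?_) hx
    obtain ⟨x, y, hxy, rfl⟩ := Finset.card_eq_two.1 (show σ.card = 2 by omega)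
    rcases lt_or_gt_of_ne hxy with h | h
    · exact hedge x y h hσ
    · rw [Finset.pair_comm] at hσ ⊢
      exact hedge y x h hσ
  rw [LinearMap.comp_apply, hx1, map_sub, hφ, hφ, if_pos hSu, if_neg hSv, sub_zero] at h0
  exact one_ne_zero h0

theorem IsCohenMacaulay.link (hK : K.IsCohenMacaulay F) {σ : Finset V} (hσ : K.IsFace σ) :
    (K.link σ).IsCohenMacaulay F := by
  intro τ hτ
  obtain ⟨h1, h2⟩ := (isFace_link hσ).1 hτ
  rw [link_link hσ h2]
  exact hK _ h1

/-- Cohen-Macaulay complexes are pure. By induction on the dimension the links of vertices are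
pure, so that lying in a face of the maximal cardinality `n` is inherited along edges, and the
complex is connected. -/
theorem IsCohenMacaulay.exists_superset_card_eq {n : ℕ} (hK : K.IsCohenMacaulay F)
    (hn : ∀ σ, K.IsFace σ → σ.card ≤ n) (hex : ∃ ρ, K.IsFace ρ ∧ ρ.card = n) {σ : Finset V}
    (hσ : K.IsFace σ) : ∃ ρ, K.IsFace ρ ∧ σ ⊆ ρ ∧ ρ.card = n := by
  induction n generalizing K σ with
  | zero => exact ⟨σ, hσ, subset_rfl, Nat.le_zero.1 (hn σ hσ)⟩
  | succ n ih =>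
    -- a vertex in a face of cardinality `n + 1` has a pure link of dimension `n - 1`
    have key : ∀ v, (∃ ρ, K.IsFace ρ ∧ v ∈ ρ ∧ ρ.card = n + 1) → ∀ τ, K.IsFace τ → v ∈ τ →
        ∃ ρ, K.IsFace ρ ∧ τ ⊆ ρ ∧ ρ.card = n + 1 := by
      rintro v ⟨ρ, hρ, hvρ, hρn⟩ τ hτ hvτ
      have hv : K.IsFace {v} := hρ.subset (Finset.singleton_subset_iff.2 hvρ)
      have hlink : ∀ α, K.IsFace α → v ∈ α → (K.link {v}).IsFace (α.erase v) := by
        intro α hα hvα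
        rw [isFace_link hv, Finset.union_comm, ← Finset.insert_eq, Finset.insert_erase hvα]
        exact ⟨hα, by simp⟩
      obtain ⟨α, hα, hτα, hαn⟩ := ih (hK.link hv) (fun α hα => by
          obtain ⟨h1, h2⟩ := (isFace_link hv).1 hα
          have h3 := hn _ h1
          rw [Finset.card_union_of_disjoint h2, Finset.card_singleton] at h3
          omega)
        ⟨ρ.erase v, hlink ρ hρ hvρ, by rw [Finset.card_erase_of_mem hvρ, hρn]; rfl⟩
        (hlink τ hτ hvτ)
      obtain ⟨h1, h2⟩ := (isFace_link hv).1 hα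
      refine ⟨α ∪ {v}, h1, ?_, by rw [Finset.card_union_of_disjoint h2, hαn]; rfl⟩
      rw [← Finset.insert_erase hvτ, Finset.union_comm, ← Finset.insert_eq]
      exact Finset.insert_subset_insert v hτα
    obtain ⟨ρ, hρ, hρn⟩ := hex
    rcases σ.eq_empty_or_nonempty with rfl | ⟨v, hv⟩
    · exact ⟨ρ, hρ, Finset.empty_subset ρ, hρn⟩
    have hvK : K.IsFace {v} := hσ.subset (Finset.singleton_subset_iff.2 hv)
    refine key v ?_ σ hσ hv
    rcases Nat.eq_zero_or_pos n with rfl | hpos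
    · exact ⟨{v}, hvK, Finset.mem_singleton_self v, rfl⟩
    have hdim : (K.link ∅).dim = n := by
      rw [link_empty]
      refine dim_eq (fun α hα => ?_) hρ (by omega)
      have := hn α hα
      omega
    have h0 : K.cycles F 0 ≤ K.boundaries F 0 := by
      rw [← subsingleton_reducedHomology_iff]
      have := hK ∅ (Or.inl rfl) 0 (by omega)
      rwa [link_empty] at this
    obtain ⟨u, hu⟩ : ρ.Nonempty := Finset.card_pos.1 (by omega)
    refine forall_vertex_of_edge h0 (S := fun x => ∃ ρ, K.IsFace ρ ∧ x ∈ ρ ∧ ρ.card = n + 1)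
      (fun x y hxy hx => ?_) (hρ.subset (Finset.singleton_subset_iff.2 hu)) hvK ⟨ρ, hρ, hu, hρn⟩
    obtain ⟨α, hα, h1, h2⟩ := key x hx {x, y} hxy (by simp)
    exact ⟨α, hα, h1 (by simp), h2⟩

end Purity

/-! ### Depth through the homology of links -/

section Depth

variable (F : Type*) [Field F] [LinearOrder V]

/-- The condition that, for every face `σ`, the reduced homology of the link of `σ` in the whole
complex vanishes in all degrees `i < d - |σ|`. It characterizes `d ≤ depth` without reference to
skeleta. -/
def LinksAcyclicBelow (K : PreAbstractSimplicialComplex V) (d : ℤ) : Prop :=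
  ∀ σ, K.IsFace σ → ∀ i : ℤ, i < d - σ.card → (K.link σ).cycles F i ≤ (K.link σ).boundaries F i

variable {F} {K L : PreAbstractSimplicialComplex V}

theorem LinksAcyclicBelow.mono {d e : ℤ} (h : K.LinksAcyclicBelow F d) (he : e ≤ d) :
    K.LinksAcyclicBelow F e :=
  fun σ hσ i hi => h σ hσ i (by omega)

/-- A face of maximal dimension has the link `{∅}`, whose reduced homology in degree `-1` does not
vanish. -/
theorem LinksAcyclicBelow.le_dim {d : ℤ} (h : K.LinksAcyclicBelow F d)
    (hK : K.FiniteDimensional) : d ≤ K.dim := by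
  obtain ⟨σ, hσ, hdim⟩ := hK.exists_card_eq_dim
  by_contra! hd
  obtain ⟨v, hv⟩ := exists_vertex (h σ hσ (-1) (by omega))
  obtain ⟨h1, h2⟩ := (isFace_link hσ).1 hv
  have h3 := hK.card_le_dim h1
  rw [Finset.card_union_of_disjoint h2, Finset.card_singleton] at h3
  omega

theorem isFace_link_skeleton {d : ℤ} {σ τ : Finset V} (hσ : K.IsFace σ)
    (hd : (σ.card : ℤ) - 1 ≤ d) :
    ((K.skeleton d).link σ).IsFace τ ↔ (K.link σ).IsFace τ ∧ (τ.card : ℤ) - 1 ≤ d - σ.card := by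
  have hd' : -1 ≤ d := by omega
  rw [isFace_link ((isFace_skeleton hd').2 ⟨hσ, hd⟩), isFace_link hσ, isFace_skeleton hd',
    and_right_comm]
  refine and_congr_right fun h => ?_
  rw [Finset.card_union_of_disjoint h.2]
  omega

theorem cycles_link_skeleton_le_iff {d i : ℤ} {σ : Finset V} (hσ : K.IsFace σ)
    (hd : (σ.card : ℤ) - 1 ≤ d) (hi : i < d - σ.card) :
    ((K.skeleton d).link σ).cycles F i ≤ ((K.skeleton d).link σ).boundaries F i ↔
      (K.link σ).cycles F i ≤ (K.link σ).boundaries F i := by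
  refine cycles_le_boundaries_congr fun τ hτ => ?_
  rw [isFace_link_skeleton hσ hd]
  exact and_iff_left (by omega)

/-- The faces of dimension at most `d` have the same links in the `d`-skeleton as in the whole
complex, up to dimension `d - |σ|`. For `σ` in the skeleton this bounds the dimension of the link
from above; purity of Cohen-Macaulay complexes gives equality, so that the two ranges of vanishing
degrees coincide. -/
theorem linksAcyclicBelow_iff (hK : K.FiniteDimensional) {d : ℤ} (hd : -1 ≤ d) :
    K.LinksAcyclicBelow F d ↔ d ≤ K.dim ∧ (K.skeleton d).IsCohenMacaulay F := by
  constructor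
  · refine fun h => ⟨h.le_dim hK, fun σ hσ i hi => ?_⟩
    rw [isFace_skeleton hd] at hσ
    have hdim : ((K.skeleton d).link σ).dim ≤ d - σ.card :=
      dim_le fun τ hτ => ((isFace_link_skeleton hσ.1 hσ.2).1 hτ).2
    have hi' : i < d - σ.card := by omega
    rw [subsingleton_reducedHomology_iff, cycles_link_skeleton_le_iff hσ.1 hσ.2 hi']
    exact h σ hσ.1 i hi'
  · rintro ⟨hdK, hCM⟩ σ hσ i hi
    by_cases hσd : (σ.card : ℤ) - 1 ≤ d
    · rw [← cycles_link_skeleton_le_iff hσ hσd hi, ← subsingleton_reducedHomology_iff]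
      refine hCM σ ((isFace_skeleton hd).2 ⟨hσ, hσd⟩) i (hi.trans_eq ?_)
      obtain ⟨n, hn⟩ : ∃ n : ℕ, (n : ℤ) = d + 1 := ⟨(d + 1).toNat, by omega⟩
      -- the skeleton has a face of dimension `d`, hence by purity one that contains `σ`
      obtain ⟨ρ, hρ, hσρ, hρn⟩ : ∃ ρ, (K.skeleton d).IsFace ρ ∧ σ ⊆ ρ ∧ ρ.card = n := by
        refine hCM.exists_superset_card_eq (fun τ hτ => ?_) ?_
          ((isFace_skeleton hd).2 ⟨hσ, hσd⟩)
        · have := ((isFace_skeleton hd).1 hτ).2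
          omega
        · obtain ⟨τ, hτ, hτd⟩ := hK.exists_card_eq_dim
          obtain ⟨ρ, hρτ, hρ⟩ := Finset.exists_subset_card_eq (show n ≤ τ.card by omega)
          exact ⟨ρ, (isFace_skeleton hd).2 ⟨hτ.subset hρτ, by omega⟩, hρ⟩
      have hlink : (K.link σ).IsFace (ρ \ σ) := by
        rw [isFace_link hσ, Finset.sdiff_union_of_subset hσρ]
        exact ⟨((isFace_skeleton hd).1 hρ).1, Finset.sdiff_disjoint⟩
      have hcard := Finset.card_sdiff_add_card_eq_card hσρ
      exact (dim_eq (fun τ hτ => ((isFace_link_skeleton hσ hσd).1 hτ).2)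
        ((isFace_link_skeleton hσ hσd).2 ⟨hlink, by omega⟩) (by omega)).symm
    · rw [cycles, chains_eq_bot _ (by omega), bot_inf_eq]
      exact bot_le

theorem neg_one_le_depth (hK : K.FiniteDimensional) : -1 ≤ K.depth F :=
  (K.isGreatest_depth F hK).1.1

theorem le_depth_iff (hK : K.FiniteDimensional) {d : ℤ} (hd : -1 ≤ d) :
    d ≤ K.depth F ↔ K.LinksAcyclicBelow F d := by
  have hg := K.isGreatest_depth F hK
  constructor
  · exact ((linksAcyclicBelow_iff hK hg.1.1).2 hg.1.2).mono
  · exact fun h => hg.2 ⟨hd, (linksAcyclicBelow_iff hK hd).1 h⟩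

theorem mem_vertices_of_isFace_link {σ τ : Finset V} (hσ : K.IsFace σ)
    (hτ : (K.link σ).IsFace τ) : ∀ v ∈ τ, v ∈ K.vertices :=
  fun _ hv => ((isFace_link hσ).1 hτ).1.mem_vertices (Finset.mem_union_left σ hv)

theorem LinksAcyclicBelow.join (hKL : Disjoint K.vertices L.vertices) {d e : ℤ}
    (hK : K.LinksAcyclicBelow F d) (hL : L.LinksAcyclicBelow F e) :
    (K.join L).LinksAcyclicBelow F (d + e + 1) := by
  intro ρ hρ i hi
  obtain ⟨σ, τ, hσ, hτ, rfl⟩ := isFace_join.1 hρ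
  rw [Finset.card_union_of_disjoint (Finset.disjoint_left.2 fun v h1 h2 =>
    Set.disjoint_left.1 hKL (hσ.mem_vertices h1) (hτ.mem_vertices h2))] at hi
  rw [link_join hKL hσ hτ]
  exact cycles_join_le_boundaries (P := (· ∈ K.vertices))
    (fun α hα => mem_vertices_of_isFace_link hσ hα)
    (fun β hβ v hv => Set.disjoint_right.1 hKL (mem_vertices_of_isFace_link hτ hβ v hv))
    (hK σ hσ) (hL τ hτ) (by push_cast at hi; omega)

theorem not_linksAcyclicBelow_join (hKL : Disjoint K.vertices L.vertices) {d e : ℤ}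
    (hK : ¬ K.LinksAcyclicBelow F (d + 1)) (hL : ¬ L.LinksAcyclicBelow F (e + 1)) :
    ¬ (K.join L).LinksAcyclicBelow F (d + e + 2) := by
  simp only [LinksAcyclicBelow, not_forall] at hK hL
  obtain ⟨σ, hσ, i, hi, hKi⟩ := hK
  obtain ⟨τ, hτ, j, hj, hLj⟩ := hL
  intro h
  have hcard := Finset.card_union_of_disjoint (Finset.disjoint_left.2 fun v h1 h2 =>
    Set.disjoint_left.1 hKL (hσ.mem_vertices h1) (hτ.mem_vertices h2))
  have h' := h (σ ∪ τ) (isFace_join.2 ⟨σ, τ, hσ, hτ, rfl⟩) (i + j + 1) (by omega)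
  rw [link_join hKL hσ hτ] at h'
  exact not_cycles_join_le_boundaries (P := (· ∈ K.vertices))
    (fun α hα => mem_vertices_of_isFace_link hσ hα)
    (fun β hβ v hv => Set.disjoint_right.1 hKL (mem_vertices_of_isFace_link hτ hβ v hv))
    hKi hLj h'

end Depth

end PreAbstractSimplicialComplex

theorem lemma2p6 {F : Type*} [Field F] {V : Type*} [LinearOrder V]
    (Δ₁ Δ₂ : PreAbstractSimplicialComplex V)
    (h₁ : Δ₁.FiniteDimensional) (h₂ : Δ₂.FiniteDimensional)
    (hdisj : Disjoint Δ₁.vertices Δ₂.vertices) :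
    (Δ₁.join Δ₂).depth F = Δ₁.depth F + Δ₂.depth F + 1 := by
  have hd₁ := PreAbstractSimplicialComplex.neg_one_le_depth (F := F) h₁
  have hd₂ := PreAbstractSimplicialComplex.neg_one_le_depth (F := F) h₂
  have h := h₁.join h₂
  refine le_antisymm ?_ ?_
  · by_contra! hlt
    have hn₁ : ¬ Δ₁.LinksAcyclicBelow F (Δ₁.depth F + 1) := by
      rw [← PreAbstractSimplicialComplex.le_depth_iff h₁ (by omega)]
      omega
    have hn₂ : ¬ Δ₂.LinksAcyclicBelow F (Δ₂.depth F + 1) := by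
      rw [← PreAbstractSimplicialComplex.le_depth_iff h₂ (by omega)]
      omega
    refine PreAbstractSimplicialComplex.not_linksAcyclicBelow_join hdisj hn₁ hn₂ ?_
    rw [← PreAbstractSimplicialComplex.le_depth_iff h (by omega)]
    omega
  · rw [PreAbstractSimplicialComplex.le_depth_iff h (by omega)]
    exact ((PreAbstractSimplicialComplex.le_depth_iff h₁ hd₁).1 le_rfl).join hdisj
      ((PreAbstractSimplicialComplex.le_depth_iff h₂ hd₂).1 le_rfl)
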